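/- **Proposition 1 (tighter concentration bound of reward).** Let $\mathcal S,\mathcal A$ be finite state and action spaces, $\mathcal D$ a finite set with $2\le|\mathcal D|<|\mathcal S||\mathcal A|$, and $\phi:\mathcal S\times\mathcal A\to\mathcal D$ a surjective map (the latent-reward encoder). Assume that the true reward factors as $r(s,a)=f(\phi(s,a))$ for some $f:\mathcal D\to\mathbb R$ with $\|f\|_2\le\sqrt{|\mathcal D|}$; below, $r$ also denotes the vector $f\in\mathbb R^{\mathcal D}$. Let $T\in\mathbb N$ be the episode length, and let $(s^k_t,a^k_t)_{t\le T}$ be the trajectory of episode $k=1,2,\dots$, generated in an arbitrary, possibly adaptive, way; put $z^k_t=\phi(s^k_t,a^k_t)$. In episode $k$ noisy rewards $\bar r_k(z^k_t,t)\in[0,1]$ are drawn, $t=1,\dots,T$, and only their sum, the episodic return $R_k=\sum_{t=1}^T\bar r_k(z^k_t,t)$, is observed. Assume that there is a filtration $(\mathcal F_k)_{k\ge0}$ such that the trajectory of episode $k$ is $\mathcal F_{k-1}$-measurable, $R_k$ is $\mathcal F_k$-measurable and, conditionally on $\mathcal F_{k-1}$, the rewards $\bar r_k(z^k_t,t)$,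 $t=1,\dots,T$, are independent with means $r(s^k_t,a^k_t)$. Let $\hat h^\phi_k\in\mathbb R^{\mathcal D}$, $\hat h^\phi_k(d)=\sum_{t=1}^T\mathbb 1(z^k_t=d)$, be the vector of latent-reward visitation counts of episode $k$. For $\lambda>0$ and $k\ge0$ let $H^\phi_k\in\mathbb R^{k\times\mathcal D}$ be the matrix with rows $(\hat h^\phi_1)^\top,\dots,(\hat h^\phi_k)^\top$, let $A^\phi_k=(H^\phi_k)^\top H^\phi_k+\lambda I$, and let $$\hat r^\phi_k=(A^\phi_k)^{-1}\sum_{l=1}^k R_l\,\hat h^\phi_l,$$ i.e. the minimizer over $x\in\mathbb R^{\mathcal D}$ of $\sum_{l=1}^k(\langle\hat h^\phi_l,x\rangle-R_l)^2+\lambda\|x\|_2^2$. Write $\|x\|_M=\sqrt{x^\top Mx}$. Then for every $\delta\in(0,1)$, with probability greater than $1-\delta/10$, simultaneously for all $k\ge0$, $$\|r-\hat r^\phi_k\|_{A^\phi_k}\le\sqrt{\tfrac14T|\mathcal D|\log\frac{1+kT^2/\lambda}{\delta/10}}+\sqrt{\lambda|\mathcal D|}=:l^\phi_k .$$ Moreover,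 for every $k\ge0$, $l^\phi_k$ is strictly smaller than the corresponding quantity for the raw state-action space, $$l^\phi_k<l_k:=\sqrt{\tfrac14T|\mathcal S||\mathcal A|\log\frac{1+kT^2/\lambda}{\delta/10}}+\sqrt{\lambda|\mathcal S||\mathcal A|}.$$ -/

import Mathlib

open MeasureTheory ProbabilityTheory Matrix

noncomputable section

namespace LatentReward

/-- Latent-reward visitation `ν̂(d, t) = 𝟙(d = z_t)` of the latent trajectory `z_1, …, z_T`
of one episode. -/
def visit {D : Type*} [DecidableEq D] {T : ℕ} (z : Fin T → D) (d : D) (t : Fin T) : ℝ :=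
  if d = z t then 1 else 0

/-- Latent-reward frequency vector `ĥ(d) = ∑ₜ ν̂(d, t)` of one episode. -/
def freq {D : Type*} [DecidableEq D] {T : ℕ} (z : Fin T → D) (d : D) : ℝ :=
  ∑ t, visit z d t

/-- Episodic return `R = r̄ᵀ ν̂`, where `rbar t d` is the noisy reward of latent `d` at step `t`. -/
def episodicReturn {D : Type*} [Fintype D] [DecidableEq D] {T : ℕ}
    (rbar : Fin T → D → ℝ) (z : Fin T → D) : ℝ :=
  ∑ t, ∑ d, rbar t d * visit z d t

/-- The matrix `H_k` whose rows are the frequency vectors of the first `k` episodes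
(episodes are numbered from `0`). -/
def designMatrix {D : Type*} (h : ℕ → D → ℝ) (k : ℕ) : Matrix (Fin k) D ℝ :=
  Matrix.of fun l d => h l d

/-- `A_k = H_kᵀ H_k + λ I`. -/
def gram {D : Type*} [DecidableEq D] (lam : ℝ) (h : ℕ → D → ℝ) (k : ℕ) :
    Matrix D D ℝ :=
  (designMatrix h k)ᵀ * designMatrix h k + lam • (1 : Matrix D D ℝ)

/-- `Y_k = ∑_{l ≤ k} R_l ĥ_l`. -/
def response {D : Type*} (h : ℕ → D → ℝ) (R : ℕ → ℝ) (k : ℕ) : D → ℝ :=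
  ∑ l ∈ Finset.range k, R l • h l

/-- The ridge-regression reward estimate `r̂_k = A_k⁻¹ Y_k`. -/
def ridge {D : Type*} [Fintype D] [DecidableEq D] (lam : ℝ) (h : ℕ → D → ℝ) (R : ℕ → ℝ)
    (k : ℕ) : D → ℝ :=
  (gram lam h k)⁻¹ *ᵥ response h R k

/-- The regularized least-squares objective `∑_{l ≤ k} (⟨ĥ_l, x⟩ - R_l)² + λ ‖x‖₂²`. -/
def ridgeObjective {D : Type*} [Fintype D] (lam : ℝ) (h : ℕ → D → ℝ) (R : ℕ → ℝ)
    (k : ℕ) (x : D → ℝ) : ℝ :=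
  ∑ l ∈ Finset.range k, (h l ⬝ᵥ x - R l) ^ 2 + lam * (x ⬝ᵥ x)

/-- `‖x‖_M = √(xᵀ M x)`. -/
def matNorm {D : Type*} [Fintype D] (M : Matrix D D ℝ) (x : D → ℝ) : ℝ :=
  √(x ⬝ᵥ (M *ᵥ x))

/-- The radius `√(¼ T n log((1 + k T² / λ) / (δ / 10))) + √(λ n)` for a reward vector with `n`
entries. -/
def radius (T n : ℕ) (lam δ : ℝ) (k : ℕ) : ℝ :=
  √(1 / 4 * T * n * Real.log ((1 + k * (T : ℝ) ^ 2 / lam) / (δ / 10))) + √(lam * n)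

theorem episodicReturn_eq {D : Type*} [Fintype D] [DecidableEq D] {T : ℕ}
    (rbar : Fin T → D → ℝ) (z : Fin T → D) :
    episodicReturn rbar z = ∑ t, rbar t (z t) := by
  simp [episodicReturn, visit]

theorem gram_mulVec {D : Type*} [Fintype D] [DecidableEq D] (lam : ℝ) (h : ℕ → D → ℝ) (k : ℕ)
    (x : D → ℝ) :
    gram lam h k *ᵥ x = ∑ l ∈ Finset.range k, (h l ⬝ᵥ x) • h l + lam • x := by
  rw [gram, add_mulVec, smul_mulVec, one_mulVec, ← mulVec_mulVec]
  congr 1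
  ext d
  simp only [mulVec, dotProduct, designMatrix, transpose_apply, of_apply, Finset.sum_apply,
    Pi.smul_apply, smul_eq_mul, Finset.sum_range]
  exact Finset.sum_congr rfl fun _ _ => mul_comm _ _

theorem dotProduct_gram {D : Type*} [Fintype D] [DecidableEq D] (lam : ℝ) (h : ℕ → D → ℝ) (k : ℕ)
    (u x : D → ℝ) :
    u ⬝ᵥ (gram lam h k *ᵥ x)
      = ∑ l ∈ Finset.range k, (h l ⬝ᵥ x) * (h l ⬝ᵥ u) + lam * (u ⬝ᵥ x) := by
  rw [gram_mulVec, dotProduct_add, dotProduct_sum, dotProduct_smul, smul_eq_mul]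
  congr 1
  exact Finset.sum_congr rfl fun l _ => by rw [dotProduct_smul, smul_eq_mul, dotProduct_comm u]

theorem dotProduct_self_pos' {D : Type*} [Fintype D] {u : D → ℝ} (hu : u ≠ 0) :
    0 < u ⬝ᵥ u :=
  lt_of_le_of_ne (Finset.sum_nonneg fun i _ => mul_self_nonneg (u i))
    (fun h => hu (dotProduct_self_eq_zero.1 h.symm))

theorem gram_mulVec_ridge {D : Type*} [Fintype D] [DecidableEq D] {lam : ℝ} (hlam : 0 < lam)
    (h : ℕ → D → ℝ) (R : ℕ → ℝ) (k : ℕ) :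
    gram lam h k *ᵥ ridge lam h R k = response h R k := by
  have hinj : Function.Injective (gram lam h k).mulVec := by
    intro x y hxy
    by_contra hne
    have hz : gram lam h k *ᵥ (x - y) = 0 := by
      rw [mulVec_sub]; exact sub_eq_zero.2 hxy
    have h1 := dotProduct_gram lam h k (x - y) (x - y)
    rw [hz, dotProduct_zero] at h1
    have h2 := mul_pos hlam (dotProduct_self_pos' (sub_ne_zero.2 hne))
    have h3 : 0 ≤ ∑ l ∈ Finset.range k, (h l ⬝ᵥ (x - y)) * (h l ⬝ᵥ (x - y)) :=
      Finset.sum_nonneg fun _ _ => mul_self_nonneg _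
    linarith
  have hu := (isUnit_iff_isUnit_det _).1 (mulVec_injective_iff_isUnit.1 hinj)
  rw [ridge, mulVec_mulVec, mul_nonsing_inv _ hu, one_mulVec]

/-- `ridge` is the unique minimizer of the regularized least-squares objective. -/
theorem isMinOn_ridgeObjective_iff {D : Type*} [Fintype D] [DecidableEq D] {lam : ℝ}
    (hlam : 0 < lam) (h : ℕ → D → ℝ) (R : ℕ → ℝ) (k : ℕ) (x : D → ℝ) :
    IsMinOn (ridgeObjective lam h R k) Set.univ x ↔ x = ridge lam h R k := by
  have key : ∀ u : D → ℝ, ridgeObjective lam h R k (ridge lam h R k + u)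
      = ridgeObjective lam h R k (ridge lam h R k)
        + (∑ l ∈ Finset.range k, (h l ⬝ᵥ u) ^ 2 + lam * (u ⬝ᵥ u)) := by
    intro u
    have h1 := dotProduct_gram lam h k u (ridge lam h R k)
    rw [gram_mulVec_ridge hlam, response, dotProduct_sum] at h1
    have h2 : ∑ l ∈ Finset.range k, u ⬝ᵥ (R l • h l) = ∑ l ∈ Finset.range k, R l * (h l ⬝ᵥ u) :=
      Finset.sum_congr rfl fun l _ => by rw [dotProduct_smul, smul_eq_mul, dotProduct_comm u]
    rw [h2] at h1
    set p := ridge lam h R k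
    have h3 : ∑ l ∈ Finset.range k, (h l ⬝ᵥ (p + u) - R l) ^ 2
        = ∑ l ∈ Finset.range k, (h l ⬝ᵥ p - R l) ^ 2 + ∑ l ∈ Finset.range k, (h l ⬝ᵥ u) ^ 2
          + 2 * (∑ l ∈ Finset.range k, (h l ⬝ᵥ p) * (h l ⬝ᵥ u)
            - ∑ l ∈ Finset.range k, R l * (h l ⬝ᵥ u)) := by
      rw [← Finset.sum_sub_distrib, Finset.mul_sum, ← Finset.sum_add_distrib,
        ← Finset.sum_add_distrib]
      exact Finset.sum_congr rfl fun l _ => by rw [dotProduct_add]; ring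
    have h4 : (p + u) ⬝ᵥ (p + u) = p ⬝ᵥ p + u ⬝ᵥ u + 2 * (u ⬝ᵥ p) := by
      rw [dotProduct_add, add_dotProduct, add_dotProduct, dotProduct_comm p u]; ring
    rw [ridgeObjective, ridgeObjective, h3, h4]
    linarith
  have hsq : ∀ u : D → ℝ, 0 ≤ ∑ l ∈ Finset.range k, (h l ⬝ᵥ u) ^ 2 :=
    fun u => Finset.sum_nonneg fun _ _ => sq_nonneg _
  constructor
  · intro hx
    by_contra hne
    have h1 := key (x - ridge lam h R k)
    rw [add_sub_cancel] at h1
    have h2 : ridgeObjective lam h R k x ≤ _ := hx (Set.mem_univ (ridge lam h R k))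
    have h3 := mul_pos hlam (dotProduct_self_pos' (sub_ne_zero.2 hne))
    have h4 := hsq (x - ridge lam h R k)
    linarith
  · rintro rfl y -
    have h1 := key (y - ridge lam h R k)
    rw [add_sub_cancel] at h1
    have h3 : 0 ≤ (y - ridge lam h R k) ⬝ᵥ (y - ridge lam h R k) :=
      Finset.sum_nonneg fun i _ => mul_self_nonneg _
    have h4 := hsq (y - ridge lam h R k)
    have h5 := mul_nonneg hlam.le h3
    show ridgeObjective lam h R k (ridge lam h R k) ≤ ridgeObjective lam h R k y
    linarith

end LatentReward

end

/-! Put `η l = R l - ⟨h l, f⟩` and `S k = ∑_{l < k} η l • h l`. The normal equations give `f - r̂ =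
λ A⁻¹ f - A⁻¹ S`, so the error in the `A`-norm is at most `‖S‖` in the `A⁻¹`-norm plus `√(λ ‖f‖²) ≤
√(λ |D|)`.

The first term is controlled by the method of mixtures. Given `𝓖 k`, `h k` is known and `η k` is a
centered sum of `T` independent `[0, 1]`-valued rewards, hence sub-Gaussian with proxy `v = T/4`.
This makes `√(λ^|D| / det A) * exp (‖S‖² / (2v))` a nonnegative supermartingale starting at `1`. No
Gaussian integral over `ℝ^D` is needed: by rank-one updates (`det_gram_succ`, `selfNormSq_succ`) the
ratio of consecutive terms involves a scalar Gaussian mixture only, bounded in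
`lintegral_exp_mixture_le`.

Ville's inequality keeps the process below `10/δ` for all `k` at once, outside an event of
probability strictly less than `δ/10`. Taking logarithms there, with `det A ≤ (λ + k T²)^|D|` and
`|D| ≥ 2`, gives the radius. -/

noncomputable section

namespace LatentReward

open scoped ENNReal NNReal

/-! ### Linear algebra of the regularized Gram matrix -/

section Gram

theorem dotProduct_sq_le {D : Type*} [Fintype D] (x y : D → ℝ) :
    (x ⬝ᵥ y) ^ 2 ≤ (x ⬝ᵥ x) * (y ⬝ᵥ y) := by
  simpa [dotProduct, sq] using Finset.sum_mul_sq_le_sq_mul_sq Finset.univ x y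

theorem gram_succ {D : Type*} [DecidableEq D] (lam : ℝ) (h : ℕ → D → ℝ) (k : ℕ) :
    gram lam h (k + 1) = gram lam h k + vecMulVec (h k) (h k) := by
  ext i j
  simp only [gram, designMatrix, Matrix.add_apply, mul_apply, transpose_apply, of_apply,
    vecMulVec_apply, Fin.sum_univ_castSucc, Fin.val_castSucc, Fin.val_last]
  ring

theorem isSymm_gram {D : Type*} [DecidableEq D] (lam : ℝ) (h : ℕ → D → ℝ) (k : ℕ) : (gram lam h k).IsSymm := by
  simp [Matrix.IsSymm, gram, transpose_mul]

variable {D : Type*} [Fintype D] [DecidableEq D] {lam : ℝ}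

theorem mul_dotProduct_self_le_gram (h : ℕ → D → ℝ) (k : ℕ) (x : D → ℝ) :
    lam * (x ⬝ᵥ x) ≤ x ⬝ᵥ (gram lam h k *ᵥ x) := by
  rw [dotProduct_gram]
  have : 0 ≤ ∑ l ∈ Finset.range k, (h l ⬝ᵥ x) * (h l ⬝ᵥ x) :=
    Finset.sum_nonneg fun _ _ => mul_self_nonneg _
  linarith

theorem posDef_gram (hlam : 0 < lam) (h : ℕ → D → ℝ) (k : ℕ) : (gram lam h k).PosDef := by
  refine Matrix.PosDef.of_dotProduct_mulVec_pos ?_ fun x hx => ?_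
  · rw [Matrix.IsHermitian, conjTranspose_eq_transpose_of_trivial]
    exact isSymm_gram lam h k
  · rw [star_trivial]
    exact (mul_pos hlam (dotProduct_self_pos' hx)).trans_le (mul_dotProduct_self_le_gram h k x)

theorem dotProduct_gram_comm (h : ℕ → D → ℝ) (k : ℕ) (x y : D → ℝ) :
    x ⬝ᵥ (gram lam h k *ᵥ y) = y ⬝ᵥ (gram lam h k *ᵥ x) := by
  rw [dotProduct_gram, dotProduct_gram, dotProduct_comm x y]
  simp only [mul_comm]

/-- `‖h_k‖²` in the norm of `A_k⁻¹`. -/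
def leverage (lam : ℝ) (h : ℕ → D → ℝ) (k : ℕ) : ℝ :=
  h k ⬝ᵥ ((gram lam h k)⁻¹ *ᵥ h k)

/-- `‖S_k‖²` in the norm of `A_k⁻¹`, where `S_k = ∑_{l < k} η_l h_l`. -/
def selfNormSq (lam : ℝ) (h : ℕ → D → ℝ) (η : ℕ → ℝ) (k : ℕ) : ℝ :=
  response h η k ⬝ᵥ ridge lam h η k

theorem gram_mulVec_inv (hlam : 0 < lam) (h : ℕ → D → ℝ) (k : ℕ) (x : D → ℝ) :
    gram lam h k *ᵥ ((gram lam h k)⁻¹ *ᵥ x) = x := by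
  rw [mulVec_mulVec, mul_nonsing_inv _ (posDef_gram hlam h k).det_pos.ne'.isUnit, one_mulVec]

theorem inv_mulVec_gram (hlam : 0 < lam) (h : ℕ → D → ℝ) (k : ℕ) (x : D → ℝ) :
    (gram lam h k)⁻¹ *ᵥ (gram lam h k *ᵥ x) = x := by
  rw [mulVec_mulVec, nonsing_inv_mul _ (posDef_gram hlam h k).det_pos.ne'.isUnit, one_mulVec]

theorem leverage_nonneg (hlam : 0 < lam) (h : ℕ → D → ℝ) (k : ℕ) : 0 ≤ leverage lam h k := by
  have := (posDef_gram hlam h k).inv.posSemidef.dotProduct_mulVec_nonneg (h k)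
  rwa [star_trivial] at this

theorem selfNormSq_eq (hlam : 0 < lam) (h : ℕ → D → ℝ) (η : ℕ → ℝ) (k : ℕ) :
    selfNormSq lam h η k = ridge lam h η k ⬝ᵥ (gram lam h k *ᵥ ridge lam h η k) := by
  rw [gram_mulVec_ridge hlam, selfNormSq, dotProduct_comm]

theorem selfNormSq_nonneg (hlam : 0 < lam) (h : ℕ → D → ℝ) (η : ℕ → ℝ) (k : ℕ) :
    0 ≤ selfNormSq lam h η k := by
  have := (posDef_gram hlam h k).posSemidef.dotProduct_mulVec_nonneg (ridge lam h η k)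
  rwa [star_trivial, ← selfNormSq_eq hlam] at this

/-- Matrix determinant lemma for a rank-one update. The factor cancels the `√(1 + w)` of the scalar
Gaussian mixture. -/
theorem det_gram_succ (hlam : 0 < lam) (h : ℕ → D → ℝ) (k : ℕ) :
    (gram lam h (k + 1)).det = (gram lam h k).det * (1 + leverage lam h k) := by
  rw [gram_succ, vecMulVec_eq Unit,
    det_add_replicateCol_mul_replicateRow (posDef_gram hlam h k).det_pos.ne'.isUnit]
  congr 1
  rw [det_unique, Matrix.add_apply, Matrix.one_apply_eq, Matrix.mul_assoc,
    ← replicateCol_mulVec, replicateRow_mul_replicateCol_apply, leverage]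

/-- Rank-one update of the self-normalized quadratic form. -/
theorem selfNormSq_succ (hlam : 0 < lam) (h : ℕ → D → ℝ) (η : ℕ → ℝ) (k : ℕ) :
    selfNormSq lam h η (k + 1) = selfNormSq lam h η k +
      (2 * η k * (h k ⬝ᵥ ridge lam h η k) + η k ^ 2 * leverage lam h k
        - (h k ⬝ᵥ ridge lam h η k) ^ 2) / (1 + leverage lam h k) := by
  have hw : 1 + leverage lam h k ≠ 0 := by linarith [leverage_nonneg hlam h k]
  set x := ridge lam h η k with hx
  set g := (gram lam h k)⁻¹ *ᵥ h k with hg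
  set u := h k ⬝ᵥ x with hu
  set w := leverage lam h k with hwdef
  have hgw : h k ⬝ᵥ g = w := rfl
  have hS : response h η (k + 1) = response h η k + η k • h k := by
    simp [response, Finset.sum_range_succ]
  have hAx : gram lam h k *ᵥ x = response h η k := gram_mulVec_ridge hlam h η k
  have hAg : gram lam h k *ᵥ g = h k := gram_mulVec_inv hlam h k _
  have hSg : response h η k ⬝ᵥ g = u := by
    rw [← hAx, dotProduct_comm, dotProduct_gram_comm, hAg, dotProduct_comm]
  -- Sherman–Morrison in guise: the candidate is checked by applying `A_{k+1} = A_k + h hᵀ`, which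
  -- avoids a formula for the inverse.
  have hridge : ridge lam h η (k + 1) = x + ((η k - u) / (1 + w)) • g := by
    have : gram lam h (k + 1) *ᵥ (x + ((η k - u) / (1 + w)) • g) = response h η (k + 1) := by
      rw [gram_succ, add_mulVec, vecMulVec_mulVec, mulVec_add, mulVec_smul, hAx, hAg, hS,
        dotProduct_add, dotProduct_smul, hgw, ← hu]
      ext d
      simp only [Pi.add_apply, Pi.smul_apply, smul_eq_mul, MulOpposite.smul_eq_mul_unop,
        MulOpposite.unop_op]
      field_simp
      ring
    rw [ridge, ← this, inv_mulVec_gram hlam]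
  have hq : selfNormSq lam h η k = response h η k ⬝ᵥ x := rfl
  rw [selfNormSq, hridge, hS, hq]
  simp only [dotProduct_add, add_dotProduct, smul_dotProduct, dotProduct_smul, smul_eq_mul, hSg,
    hgw, ← hu]
  field_simp
  ring

/-- If the rows have squared length at most `B`, then `det A_k ≤ (λ + k B) ^ |D|`. -/
theorem det_gram_le (hlam : 0 < lam) (h : ℕ → D → ℝ) {B : ℝ} (hB : ∀ l, h l ⬝ᵥ h l ≤ B) (k : ℕ) :
    (gram lam h k).det ≤ (lam + k * B) ^ Fintype.card D := by
  have hA := posDef_gram hlam h k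
  rw [hA.isHermitian.det_eq_prod_eigenvalues, ← Finset.card_univ, ← Finset.prod_const]
  -- Each eigenvalue is the quadratic form at a unit eigenvector `v`, that is `λ + ∑ ⟨h l, v⟩²`, and
  -- Cauchy–Schwarz bounds each summand by `B`.
  refine Finset.prod_le_prod (fun i _ => (hA.eigenvalues_pos i).le) fun i _ => ?_
  set v : D → ℝ := ⇑(hA.isHermitian.eigenvectorBasis i) with hv
  have hvv : v ⬝ᵥ v = 1 := by
    have h1 := hA.isHermitian.eigenvectorBasis.orthonormal.1 i
    have h2 := EuclideanSpace.real_norm_sq_eq (hA.isHermitian.eigenvectorBasis i)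
    rw [h1, one_pow] at h2
    simp only [dotProduct, ← sq]
    exact h2.symm
  have heig := dotProduct_gram lam h k v v
  rw [hA.isHermitian.mulVec_eigenvectorBasis, dotProduct_smul, hvv, smul_eq_mul, mul_one,
    mul_one] at heig
  have hsum : ∑ l ∈ Finset.range k, (h l ⬝ᵥ v) * (h l ⬝ᵥ v) ≤ ∑ _l ∈ Finset.range k, B :=
    Finset.sum_le_sum fun l _ => by
      have := dotProduct_sq_le (h l) v
      rw [hvv, mul_one, sq] at this
      exact this.trans (hB l)
  rw [Finset.sum_const, Finset.card_range, nsmul_eq_mul] at hsum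
  simp only [RCLike.ofReal_real_eq_id, id_eq]
  linarith

/-- The ridge estimation error is the self-normalized noise plus a regularization bias. -/
theorem matNorm_sub_ridge_le (hlam : 0 < lam) (h : ℕ → D → ℝ) (R : ℕ → ℝ) (f : D → ℝ) (k : ℕ) :
    matNorm (gram lam h k) (f - ridge lam h R k)
      ≤ √(selfNormSq lam h (fun l => R l - h l ⬝ᵥ f) k) + √(lam * (f ⬝ᵥ f)) := by
  set η : ℕ → ℝ := fun l => R l - h l ⬝ᵥ f
  set x := ridge lam h η k with hx
  have hlf : 0 ≤ lam * (f ⬝ᵥ f) :=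
    mul_nonneg hlam.le (Finset.sum_nonneg fun i _ => mul_self_nonneg _)
  have hRη : response h η k = response h R k
      - ∑ l ∈ Finset.range k, (h l ⬝ᵥ f) • h l := by
    simp only [response, η, sub_smul, Finset.sum_sub_distrib]
  have hA : gram lam h k *ᵥ (f - ridge lam h R k + x) = lam • f := by
    rw [mulVec_add, mulVec_sub, gram_mulVec_ridge hlam, gram_mulVec_ridge hlam, hRη, gram_mulVec]
    abel
  set e := f - ridge lam h R k with he
  have hq : selfNormSq lam h η k = x ⬝ᵥ (gram lam h k *ᵥ x) := selfNormSq_eq hlam h η k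
  have hq0 := selfNormSq_nonneg hlam h η k
  have hbound : ∀ y : D → ℝ, lam * |y ⬝ᵥ f| ≤
      √(y ⬝ᵥ (gram lam h k *ᵥ y)) * √(lam * (f ⬝ᵥ f)) := fun y => by
    have h1 : lam * (y ⬝ᵥ y) ≤ y ⬝ᵥ (gram lam h k *ᵥ y) := mul_dotProduct_self_le_gram h k y
    have h0 : 0 ≤ y ⬝ᵥ y := Finset.sum_nonneg fun i _ => mul_self_nonneg _
    rw [← Real.sqrt_mul ((mul_nonneg hlam.le h0).trans h1)]
    refine Real.le_sqrt_of_sq_le ?_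
    rw [mul_pow, sq_abs]
    nlinarith [dotProduct_sq_le y f, mul_le_mul_of_nonneg_right h1 hlf, sq_nonneg lam]
  -- `y = λ A⁻¹ f` is the regularization bias. Since `‖y‖² = λ ⟨y, f⟩` in the `A`-norm, `hbound`
  -- applied to `y` itself yields `‖y‖² ≤ λ ‖f‖²`.
  set y := e + x with hy
  have hyA : y ⬝ᵥ (gram lam h k *ᵥ y) ≤ lam * (f ⬝ᵥ f) := by
    have h1 := hbound y
    have h2 : y ⬝ᵥ (gram lam h k *ᵥ y) = lam * (y ⬝ᵥ f) := by
      rw [hA, dotProduct_smul, smul_eq_mul]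
    have h0 : 0 ≤ y ⬝ᵥ (gram lam h k *ᵥ y) :=
      (mul_nonneg hlam.le (Finset.sum_nonneg fun i _ => mul_self_nonneg _)).trans
        (mul_dotProduct_self_le_gram h k y)
    by_contra hlt
    rw [not_le] at hlt
    have h3 : √(lam * (f ⬝ᵥ f)) < √(y ⬝ᵥ (gram lam h k *ᵥ y)) := Real.sqrt_lt_sqrt hlf hlt
    nlinarith [Real.sq_sqrt h0, Real.sqrt_nonneg (lam * (f ⬝ᵥ f)), le_abs_self (y ⬝ᵥ f)]
  have hex : e = y - x := by rw [hy, add_sub_cancel_right]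
  rw [matNorm, hex]
  refine Real.sqrt_le_iff.2 ⟨by positivity, ?_⟩
  have hcross : x ⬝ᵥ (gram lam h k *ᵥ y) = lam * (x ⬝ᵥ f) := by
    rw [hA, dotProduct_smul, smul_eq_mul]
  -- The triangle inequality for `e = y - x`, by hand: the cross term is `λ ⟨x, f⟩`, to which
  -- `hbound` applies again.
  have hexp : (y - x) ⬝ᵥ (gram lam h k *ᵥ (y - x)) = y ⬝ᵥ (gram lam h k *ᵥ y)
      - 2 * (lam * (x ⬝ᵥ f)) + selfNormSq lam h η k := by
    rw [mulVec_sub, dotProduct_sub, sub_dotProduct, sub_dotProduct, dotProduct_gram_comm h k y x,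
      hcross, hq]
    ring
  rw [hexp, add_sq, Real.sq_sqrt hq0, Real.sq_sqrt hlf]
  have h5 := hbound x
  rw [← hq] at h5
  have h6 := neg_abs_le (x ⬝ᵥ f)
  nlinarith

end Gram

/-! ### The scalar Gaussian mixture -/

/-- Completing the square: a Gaussian mixture of `y ↦ exp (η y - v y² / 2)`. -/
theorem gaussianPDFReal_mul_exp (u x : ℝ) {w v : ℝ≥0} (hw : w ≠ 0) (hv : v ≠ 0) (y : ℝ) :
    √(1 + w) * (gaussianPDFReal (u / v) (w / v) y * Real.exp (x * y - v * y ^ 2 / 2))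
      = Real.exp ((2 * x * u + x ^ 2 * w - u ^ 2) / (1 + w) / (2 * v))
        * gaussianPDFReal ((u + x * w) / (v * (1 + w))) (w / (v * (1 + w))) y := by
  have hw' : (0 : ℝ) < w := by positivity
  have hv' : (0 : ℝ) < v := by positivity
  have h1w : (0 : ℝ) < 1 + w := by positivity
  simp only [gaussianPDFReal, NNReal.coe_div, NNReal.coe_mul, NNReal.coe_add, NNReal.coe_one]
  have hs : √(2 * Real.pi * (w / v)) = √(1 + w) * √(2 * Real.pi * (w / (v * (1 + w)))) := by
    rw [← Real.sqrt_mul h1w.le]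
    congr 1
    field_simp
  have hpos : 0 < √(2 * Real.pi * (w / (v * (1 + w)))) := by positivity
  have hpos' : 0 < √(1 + (w : ℝ)) := by positivity
  rw [hs, mul_assoc, ← Real.exp_add, mul_left_comm (Real.exp _), ← Real.exp_add, ← mul_assoc]
  congr 1
  · field_simp
  · congr 1
    field_simp
    ring

/-- The integrand is `√(1 + w)` times the average of `exp (X y - v y² / 2)` over `y ∼ N(u/v, w/v)`.
Each such exponential has expectation at most `1` by sub-Gaussianity, so Tonelli concludes. -/
theorem lintegral_exp_mixture_le {Ω : Type*} [MeasurableSpace Ω] {P : Measure Ω} [SFinite P]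
    {X : Ω → ℝ} {v : ℝ≥0} (hv : v ≠ 0) (hXm : Measurable X) (hX : HasSubgaussianMGF X v P)
    (u : ℝ) (w : ℝ≥0) :
    ∫⁻ ω, ENNReal.ofReal
        (Real.exp ((2 * X ω * u + X ω ^ 2 * w - u ^ 2) / (1 + w) / (2 * v))) ∂P
      ≤ ENNReal.ofReal √(1 + w) := by
  have hv' : (0 : ℝ) < v := by positivity
  have hmgf : ∀ t : ℝ, ∫⁻ ω, ENNReal.ofReal (Real.exp (X ω * t - v * t ^ 2 / 2)) ∂P ≤ 1 := by
    intro t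
    have hint : Integrable (fun ω => Real.exp (X ω * t - v * t ^ 2 / 2)) P := by
      simp only [Real.exp_sub, mul_comm _ t]
      exact (hX.integrable_exp_mul t).div_const _
    rw [← ofReal_integral_eq_lintegral_ofReal hint (ae_of_all _ fun _ => (Real.exp_pos _).le),
      ENNReal.ofReal_le_one]
    simp only [Real.exp_sub, mul_comm _ t]
    rw [integral_div]
    exact div_le_one_of_le₀ (hX.mgf_le t) (Real.exp_pos _).le
  -- At `w = 0` the Gaussian is a point mass without density, so the bound at the single point `y =
  -- u/v` is used instead.
  rcases eq_or_ne w 0 with rfl | hw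
  · have := hmgf (u / v)
    simp only [NNReal.coe_zero, mul_zero, add_zero, div_one, Real.sqrt_one, ENNReal.ofReal_one]
    convert this using 4
    field_simp
  · have hvar : w / (v * (1 + w)) ≠ 0 := by positivity
    have key : ∀ ω, ENNReal.ofReal
        (Real.exp ((2 * X ω * u + X ω ^ 2 * w - u ^ 2) / (1 + w) / (2 * v)))
        = ∫⁻ y, ENNReal.ofReal √(1 + w) * (gaussianPDF (u / v) (w / v) y
            * ENNReal.ofReal (Real.exp (X ω * y - v * y ^ 2 / 2))) := by
      intro ω
      have h1 : ∀ y, ENNReal.ofReal √(1 + w) * (gaussianPDF (u / v) (w / v) y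
            * ENNReal.ofReal (Real.exp (X ω * y - v * y ^ 2 / 2)))
          = ENNReal.ofReal
            (Real.exp ((2 * X ω * u + X ω ^ 2 * w - u ^ 2) / (1 + w) / (2 * v)))
            * gaussianPDF ((u + X ω * w) / (v * (1 + w))) (w / (v * (1 + w))) y := by
        intro y
        rw [gaussianPDF, gaussianPDF, ← ENNReal.ofReal_mul (gaussianPDFReal_nonneg _ _ _),
          ← ENNReal.ofReal_mul (Real.sqrt_nonneg _), gaussianPDFReal_mul_exp u (X ω) hw hv,
          ENNReal.ofReal_mul (Real.exp_pos _).le]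
      simp only [h1]
      rw [lintegral_const_mul _ (measurable_gaussianPDF _ _), lintegral_gaussianPDF_eq_one _ hvar,
        mul_one]
    simp only [key]
    rw [lintegral_lintegral_swap (by fun_prop)]
    have hw0 : w / v ≠ 0 := by positivity
    calc ∫⁻ y, ∫⁻ ω, ENNReal.ofReal √(1 + w) * (gaussianPDF (u / v) (w / v) y
            * ENNReal.ofReal (Real.exp (X ω * y - v * y ^ 2 / 2))) ∂P
        ≤ ∫⁻ y, ENNReal.ofReal √(1 + w) * gaussianPDF (u / v) (w / v) y := by
          refine lintegral_mono fun y => ?_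
          rw [lintegral_const_mul _ (by fun_prop), lintegral_const_mul _ (by fun_prop)]
          gcongr
          exact mul_le_of_le_one_right' (hmgf y)
      _ = ENNReal.ofReal √(1 + w) := by
          rw [lintegral_const_mul _ (measurable_gaussianPDF _ _),
            lintegral_gaussianPDF_eq_one _ hw0, mul_one]

/-! ### Maximal inequality -/

/-- **Ville's maximal inequality**, with strict inequalities, for a nonnegative supermartingale. -/
theorem measure_exists_lt_lt_inv {Ω : Type*} {mΩ : MeasurableSpace Ω} {μ : Measure Ω}
    {𝓖 : Filtration ℕ mΩ} {M : ℕ → Ω → ℝ≥0∞}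
    (hM : ∀ k, Measurable[𝓖 k] (M k)) (h0 : ∫⁻ ω, M 0 ω ∂μ ≤ 1)
    (hstep : ∀ k s, MeasurableSet[𝓖 k] s → ∫⁻ ω in s, M (k + 1) ω ∂μ ≤ ∫⁻ ω in s, M k ω ∂μ)
    {c : ℝ≥0∞} (hc : c ≠ 0) (hc' : c ≠ ∞) :
    μ {ω | ∃ k, c < M k ω} < c⁻¹ := by
  -- `B k` is first passage above `c` at time `k`; `C k` is no passage up to time `k`, and it lies
  -- in `𝓖 k`.
  set B : ℕ → Set Ω := fun k => {ω | c < M k ω ∧ ∀ j < k, M j ω ≤ c} with hB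
  set C : ℕ → Set Ω := fun k => {ω | ∀ j ≤ k, M j ω ≤ c} with hC
  have hMm : ∀ k, Measurable (M k) := fun k => (hM k).mono (𝓖.le k) le_rfl
  have hle : ∀ j k, j ≤ k → MeasurableSet[𝓖 k] {ω | M j ω ≤ c} := fun j k hjk =>
    𝓖.mono hjk _ (hM j measurableSet_Iic)
  have hCm : ∀ k, MeasurableSet[𝓖 k] (C k) := fun k => by
    have : C k = ⋂ j ∈ Finset.range (k + 1), {ω | M j ω ≤ c} := by
      ext ω; simp [hC]
    rw [this]
    exact Finset.measurableSet_biInter _ fun j hj => hle j k (by simpa [Nat.lt_succ_iff] using hj)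
  have hBm : ∀ k, MeasurableSet (B k) := fun k => by
    have : B k = {ω | c < M k ω} ∩ ⋂ j ∈ Finset.range k, {ω | M j ω ≤ c} := by
      ext ω; simp [hB]
    rw [this]
    exact (measurableSet_lt measurable_const (hMm k)).inter
      (Finset.measurableSet_biInter _ fun j _ => measurableSet_le (hMm j) measurable_const)
  have hCm' : ∀ k, MeasurableSet (C k) := fun k => 𝓖.le k _ (hCm k)
  have hdisjBC : ∀ k, Disjoint (B k) (C k) := fun k =>
    Set.disjoint_left.2 fun ω h1 h2 => (h1.1.trans_le (h2 k le_rfl)).false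
  have hsplit : ∀ k, C k = B (k + 1) ∪ C (k + 1) := fun k => by
    ext ω
    simp only [hB, hC, Set.mem_ofPred_eq, Set.mem_union, Nat.lt_succ_iff]
    constructor
    · intro h
      rcases lt_or_ge c (M (k + 1) ω) with h1 | h1
      · exact Or.inl ⟨h1, h⟩
      · refine Or.inr fun j hj => ?_
        rcases Nat.le_succ_iff.1 hj with h2 | rfl
        exacts [h j h2, h1]
    · rintro (h | h)
      exacts [h.2, fun j hj => h j (hj.trans k.le_succ)]
  -- The stopped process has total mass at most `1`. In the induction, the supermartingale step is
  -- applied on `C n = B (n + 1) ∪ C (n + 1)`.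
  have hbound : ∀ n, ∑ k ∈ Finset.range (n + 1), ∫⁻ ω in B k, M k ω ∂μ
      + ∫⁻ ω in C n, M n ω ∂μ ≤ 1 := by
    intro n
    induction n with
    | zero =>
      rw [Finset.sum_range_one, ← lintegral_union (hCm' 0) (hdisjBC 0)]
      exact (setLIntegral_le_lintegral _ _).trans h0
    | succ n ih =>
      rw [Finset.sum_range_succ, add_assoc, ← lintegral_union (hCm' _) (hdisjBC _), ← hsplit]
      exact (add_le_add_right (hstep n _ (hCm n)) _).trans ih
  have htsum : ∑' k, ∫⁻ ω in B k, M k ω ∂μ ≤ 1 :=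
    ENNReal.tsum_le_of_sum_range_le fun n =>
      (Finset.sum_le_sum_of_subset (Finset.range_subset_range.2 n.le_succ)).trans
        (le_self_add.trans (hbound n))
  have hBdisj : Pairwise (Function.onFun Disjoint B) := by
    refine (pairwise_disjoint_on B).2 fun i j hij => Set.disjoint_left.2 fun ω h1 h2 => ?_
    exact (h1.1.trans_le (h2.2 i hij)).false
  have hunion : {ω | ∃ k, c < M k ω} = ⋃ k, B k := by
    classical
    ext ω
    simp only [Set.mem_ofPred_eq, Set.mem_iUnion, hB]
    constructor
    · intro h
      exact ⟨Nat.find h, Nat.find_spec h, fun j hj => not_lt.1 (Nat.find_min h hj)⟩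
    · rintro ⟨k, hk, -⟩
      exact ⟨k, hk⟩
  rw [hunion, measure_iUnion hBdisj hBm]
  -- Source of strictness: either the event is null, or some `B k` has positive measure and `M k >
  -- c` strictly there.
  by_cases hz : ∀ k, μ (B k) = 0
  · simp only [hz, tsum_zero, ENNReal.inv_pos]
    exact hc'
  push Not at hz
  obtain ⟨k₀, hk₀⟩ := hz
  have hcle : ∀ k, c * μ (B k) ≤ ∫⁻ ω in B k, M k ω ∂μ := fun k => by
    rw [← setLIntegral_const]
    exact setLIntegral_mono (hMm k) fun ω hω => hω.1.le
  have hfin : ∀ k, ∫⁻ ω in B k, M k ω ∂μ ≠ ∞ := fun k =>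
    (((ENNReal.le_tsum k).trans htsum).trans_lt ENNReal.one_lt_top).ne
  have hlt : c * μ (B k₀) < ∫⁻ ω in B k₀, M k₀ ω ∂μ := by
    rw [← setLIntegral_const]
    refine setLIntegral_strict_mono (hBm k₀) hk₀ (hMm k₀) ?_ (ae_of_all _ fun ω hω => hω.1)
    rw [setLIntegral_const]
    exact ((hcle k₀).trans_lt (hfin k₀).lt_top).ne
  have hsum : ∑' k, c * μ (B k) < ∑' k, ∫⁻ ω in B k, M k ω ∂μ :=
    ENNReal.tsum_lt_tsum (ne_top_of_le_ne_top ENNReal.one_ne_top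
      ((ENNReal.tsum_le_tsum hcle).trans htsum)) hcle hlt
  rw [ENNReal.tsum_mul_left] at hsum
  refine lt_of_not_ge fun hge => ((hsum.trans_le htsum).trans_le ?_).false
  rw [← ENNReal.mul_inv_cancel hc hc']
  gcongr

/-! ### Conditional laws and conditional sub-Gaussianity -/

/-- Kernel independence of finitely many real random variables gives independence under almost
every measure of the kernel. -/
theorem ae_iIndepFun_of_kernel {α Ω ι : Type*} {_ : MeasurableSpace α} {_ : MeasurableSpace Ω} [Fintype ι]
    {κ : Kernel α Ω} [IsMarkovKernel κ] {ν : Measure α} {X : ι → Ω → ℝ}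
    (hX : ∀ i, Measurable (X i)) (h : Kernel.iIndepFun X κ ν) :
    ∀ᵐ a ∂ν, iIndepFun X (κ a) := by
  -- Independence holds off a null set depending on the events. Rational half-lines form a countable
  -- generating π-system, so one null set suffices.
  have hq : ∀ᵐ a ∂ν, ∀ (S : Finset ι) (q : ι → ℚ),
      κ a (⋂ i ∈ S, X i ⁻¹' Set.Iic (q i : ℝ)) = ∏ i ∈ S, κ a (X i ⁻¹' Set.Iic (q i : ℝ)) := by
    rw [ae_all_iff]
    intro S
    rw [ae_all_iff]
    intro q
    exact h S fun i _ => ⟨_, measurableSet_Iic, rfl⟩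
  filter_upwards [hq] with a ha
  rw [iIndepFun_iff_iIndep]
  refine iIndepSets.iIndep (fun i => (hX i).comap_le)
    (fun i => {s | ∃ t ∈ (⋃ q : ℚ, {Set.Iic (q : ℝ)} : Set (Set ℝ)), X i ⁻¹' t = s})
    (fun i => Real.isPiSystem_Iic_rat.comap (X i)) (fun i => ?_) ?_
  · rw [show Real.measurableSpace = borel ℝ from BorelSpace.measurable_eq,
      Real.borel_eq_generateFrom_Iic_rat, MeasurableSpace.comap_generateFrom]
    rfl
  · rw [iIndepSets_iff]
    intro S f hf
    have hf' : ∀ i, ∃ q : ℚ, i ∈ S → f i = X i ⁻¹' Set.Iic (q : ℝ) := fun i => by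
      by_cases hi : i ∈ S
      · obtain ⟨t, ht, hti⟩ := hf i hi
        obtain ⟨q, hq⟩ := Set.mem_iUnion.1 ht
        exact ⟨q, fun _ => by rw [← hti, Set.mem_singleton_iff.1 hq]⟩
      · exact ⟨0, fun h => absurd h hi⟩
    choose q hq using hf'
    rw [Set.iInter₂_congr hq, Finset.prod_congr rfl fun i hi => by rw [hq i hi]]
    exact ha S q

section CondExp

variable {Ω : Type*} {m mΩ : MeasurableSpace Ω} [StandardBorelSpace Ω]
  {μ : Measure Ω} [IsProbabilityMeasure μ]

/-- Freezing the `m`-measurable argument under the conditional distribution given `m`. -/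
theorem lintegral_diag_eq_lintegral_condExpKernel (hm : m ≤ mΩ) {F : Ω × Ω → ℝ≥0∞}
    (hF : Measurable[m.prod mΩ] F) :
    ∫⁻ ω, F (ω, ω) ∂μ = ∫⁻ ω, ∫⁻ ω', F (ω, ω') ∂(condExpKernel μ m ω) ∂(μ.trim hm) := by
  -- The trimmed measure composed with the conditional kernel is the law of `ω ↦ (ω, ω)`.
  rw [← Measure.lintegral_compProd hF, compProd_trim_condExpKernel hm]
  exact (@lintegral_map Ω (Ω × Ω) mΩ (m.prod mΩ) μ F Function.diag hF
    ((measurable_id'' hm).prodMk measurable_id)).symm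

/-- Under the conditional distribution given `m`, an `m`-measurable variable is constant. -/
theorem ae_condExpKernel_eq (hm : m ≤ mΩ) {g : Ω → ℝ} (hg : Measurable[m] g) :
    ∀ᵐ ω ∂(μ.trim hm), ∀ᵐ ω' ∂(condExpKernel μ m ω), g ω' = g ω := by
  have h1 : MeasurableSet[m.prod mΩ] {p : Ω × Ω | g p.2 = g p.1} :=
    measurableSet_eq_fun
      ((hg.mono hm le_rfl).comp (@measurable_snd _ _ m mΩ)) (hg.comp (@measurable_fst _ _ m mΩ))
  refine Measure.ae_ae_of_ae_compProd (p := fun p : Ω × Ω => g p.2 = g p.1) ?_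
  rw [compProd_trim_condExpKernel hm]
  refine (@ae_map_iff _ _ mΩ (m.prod mΩ) _ Function.diag (@Measurable.aemeasurable _ _ _
    (m.prod mΩ) _ _ ((measurable_id'' hm).prodMk measurable_id)) _ h1).2 ?_
  exact ae_of_all _ fun _ => rfl

/-- A sum of conditionally independent `[0, 1]`-valued variables, centered at its conditional
mean, is conditionally sub-Gaussian. -/
theorem hasCondSubgaussianMGF_sum_sub {ι : Type*} [Fintype ι] (hm : m ≤ mΩ) {X g : ι → Ω → ℝ}
    (hX : ∀ i, Measurable (X i)) (hg : ∀ i, Measurable[m] (g i))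
    (hbdd : ∀ i, ∀ᵐ ω ∂μ, X i ω ∈ Set.Icc (0 : ℝ) 1)
    (hmean : ∀ i, μ[X i | m] =ᵐ[μ] g i) (hind : iCondIndepFun m hm X μ) :
    HasCondSubgaussianMGF m hm (fun ω => ∑ i, X i ω - ∑ i, g i ω)
      (Fintype.card ι * (1 / 4)) μ := by
  have hae : ∀ᵐ ω ∂(μ.trim hm), HasSubgaussianMGF (fun ω => ∑ i, X i ω - ∑ i, g i ω)
      (Fintype.card ι * (1 / 4)) (condExpKernel μ m ω) := by
    have h1 := ae_iIndepFun_of_kernel hX hind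
    have h2 : ∀ᵐ ω ∂(μ.trim hm), ∀ i, ∀ᵐ ω' ∂(condExpKernel μ m ω), X i ω' ∈ Set.Icc (0 : ℝ) 1 := by
      rw [ae_all_iff]
      intro i
      refine Measure.ae_ae_of_ae_comp ?_
      rw [condExpKernel_comp_trim hm]
      exact hbdd i
    have h3 : ∀ᵐ ω ∂(μ.trim hm), ∀ i, ∀ᵐ ω' ∂(condExpKernel μ m ω), g i ω' = g i ω := by
      rw [ae_all_iff]
      exact fun i => ae_condExpKernel_eq hm (hg i)
    have h4 : ∀ᵐ ω ∂(μ.trim hm), ∀ i, ∫ ω', X i ω' ∂(condExpKernel μ m ω) = g i ω := by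
      rw [ae_all_iff]
      intro i
      have hint : Integrable (X i) μ := Integrable.of_mem_Icc 0 1 (hX i).aemeasurable (hbdd i)
      have h5 : μ[X i | m] =ᵐ[μ.trim hm] g i :=
        (stronglyMeasurable_condExp.ae_eq_trim_iff hm (hg i).stronglyMeasurable).2 (hmean i)
      filter_upwards [h5, condExp_ae_eq_trim_integral_condExpKernel hm hint] with ω h6 h7
      rw [← h7, h6]
    filter_upwards [h1, h2, h3, h4] with ω i1 i2 i3 i4
    have hc : iIndepFun (fun i ω' => X i ω' - g i ω) (condExpKernel μ m ω) :=
      i1.comp (fun i x => x - g i ω) fun i => by fun_prop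
    -- Hoeffding's lemma: an interval of length `1` gives proxy `(1/2)² = 1/4`.
    have hsub : ∀ i ∈ Finset.univ, HasSubgaussianMGF (fun ω' => X i ω' - g i ω) (1 / 4)
        (condExpKernel μ m ω) := fun i _ => by
      have := hasSubgaussianMGF_of_mem_Icc (hX i).aemeasurable (i2 i)
      rw [i4 i] at this
      convert this using 1
      ext
      norm_num
    have hsum := HasSubgaussianMGF.sum_of_iIndepFun hc hsub
    rw [Finset.sum_const, Finset.card_univ, nsmul_eq_mul] at hsum
    refine hsum.congr ?_
    filter_upwards [ae_all_iff.2 i3] with ω' hω'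
    rw [Finset.sum_sub_distrib]
    simp only [hω']
  -- What remains is integrability under `μ`, obtained by integrating the conditional bound `exp (v
  -- t² / 2)`, which does not depend on `ω`.
  refine ⟨fun t => ?_, hae.mono fun ω hω => hω.mgf_le⟩
  rw [condExpKernel_comp_trim hm]
  have hXg : Measurable fun ω => ∑ i, X i ω - ∑ i, g i ω := by
    have := fun i => (hg i).mono hm le_rfl
    fun_prop
  have hmeas : Measurable fun ω => Real.exp (t * (∑ i, X i ω - ∑ i, g i ω)) := by fun_prop
  refine ⟨hmeas.aestronglyMeasurable, ?_⟩
  rw [hasFiniteIntegral_iff_ofReal (ae_of_all _ fun _ => (Real.exp_pos _).le),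
    lintegral_diag_eq_lintegral_condExpKernel hm
      (F := fun p => ENNReal.ofReal (Real.exp (t * (∑ i, X i p.2 - ∑ i, g i p.2))))
      (hmeas.ennreal_ofReal.comp (@measurable_snd _ _ m mΩ))]
  refine (lintegral_mono_ae (g := fun _ => ENNReal.ofReal
    (Real.exp ((Fintype.card ι * (1 / 4) : ℝ≥0) * t ^ 2 / 2))) ?_).trans_lt ?_
  · filter_upwards [hae] with ω hω
    rw [← ofReal_integral_eq_lintegral_ofReal (hω.integrable_exp_mul t)
      (ae_of_all _ fun _ => (Real.exp_pos _).le)]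
    exact ENNReal.ofReal_le_ofReal (hω.mgf_le t)
  · rw [lintegral_const]
    exact ENNReal.mul_lt_top ENNReal.ofReal_lt_top (measure_lt_top _ _)

end CondExp

/-! ### Measurability of the matrix quantities -/

section Measurability

variable {Ω D : Type*} {m : MeasurableSpace Ω}

theorem measurable_gram_apply [DecidableEq D] (lam : ℝ) {h : ℕ → Ω → D → ℝ} {k : ℕ}
    (hh : ∀ l < k, Measurable (h l)) (i j : D) :
    Measurable fun ω => gram lam (fun l => h l ω) k i j := by
  simp only [gram, designMatrix, Matrix.add_apply, mul_apply, transpose_apply, of_apply]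
  have := fun l : Fin k => hh l l.2
  fun_prop

theorem measurable_response [Fintype D] {h : ℕ → Ω → D → ℝ} {η : ℕ → Ω → ℝ} {k : ℕ}
    (hh : ∀ l < k, Measurable (h l)) (hη : ∀ l < k, Measurable (η l)) :
    Measurable fun ω => response (fun l => h l ω) (fun l => η l ω) k := by
  simp only [response]
  refine Finset.measurable_sum _ fun l hl => ?_
  exact (hη l (Finset.mem_range.1 hl)).smul (hh l (Finset.mem_range.1 hl))

theorem measurable_freq [DecidableEq D] {T : ℕ} {z : Ω → Fin T → D}
    (hz : ∀ t d, Measurable fun ω => visit (z ω) d t) : Measurable fun ω => freq (z ω) :=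
  measurable_pi_lambda _ fun d => Finset.measurable_sum _ fun t _ => hz t d

variable [Fintype D]

theorem measurable_mulVec {A : Ω → Matrix D D ℝ} {x : Ω → D → ℝ}
    (hA : ∀ i j, Measurable fun ω => A ω i j) (hx : Measurable x) :
    Measurable fun ω => A ω *ᵥ x ω := by
  refine measurable_pi_lambda _ fun i => ?_
  simp only [mulVec, dotProduct]
  fun_prop

theorem measurable_dotProduct {x y : Ω → D → ℝ} (hx : Measurable x) (hy : Measurable y) :
    Measurable fun ω => x ω ⬝ᵥ y ω := by
  simp only [dotProduct]
  fun_prop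

variable [DecidableEq D]

theorem measurable_det {A : Ω → Matrix D D ℝ} (hA : ∀ i j, Measurable fun ω => A ω i j) :
    Measurable fun ω => (A ω).det := by
  simp only [det_apply']
  fun_prop

/-- Cramer's rule holds at singular matrices too, where both the matrix inverse and `det⁻¹` take the
default value `0`. -/
theorem measurable_inv_apply {A : Ω → Matrix D D ℝ} (hA : ∀ i j, Measurable fun ω => A ω i j)
    (i j : D) : Measurable fun ω => (A ω)⁻¹ i j := by
  simp only [inv_def, Ring.inverse_eq_inv', Matrix.smul_apply, smul_eq_mul, adjugate_apply]
  refine (measurable_det hA).inv.mul (measurable_det fun i' j' => ?_)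
  simp only [updateRow_apply]
  split_ifs
  · exact measurable_const
  · exact hA i' j'

end Measurability

/-! ### The self-normalized supermartingale -/

theorem ae_hasSubgaussianMGF {Ω : Type*} {m mΩ : MeasurableSpace Ω}
    [StandardBorelSpace Ω] {μ : Measure Ω} [IsProbabilityMeasure μ] {hm : m ≤ mΩ} {X : Ω → ℝ} {v : ℝ≥0}
    (h : HasCondSubgaussianMGF m hm X v μ) :
    ∀ᵐ ω ∂(μ.trim hm), HasSubgaussianMGF X v (condExpKernel μ m ω) := by
  filter_upwards [h.mgf_le, Kernel.HasSubgaussianMGF.ae_forall_integrable_exp_mul h] with ω h1 h2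
  exact ⟨h2, h1⟩

section SelfNormalized

variable {Ω D : Type*} {mΩ : MeasurableSpace Ω} [StandardBorelSpace Ω]
  {μ : Measure Ω} [IsProbabilityMeasure μ] [Fintype D] [DecidableEq D]

/-- The mixture supermartingale of the self-normalized process. -/
def mixture (lam v : ℝ) (h : ℕ → D → ℝ) (η : ℕ → ℝ) (k : ℕ) : ℝ :=
  √(lam ^ Fintype.card D / (gram lam h k).det) * Real.exp (selfNormSq lam h η k / (2 * v))

theorem mixture_zero {lam : ℝ} (hlam : 0 < lam) (v : ℝ) (h : ℕ → D → ℝ) (η : ℕ → ℝ) :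
    mixture lam v h η 0 = 1 := by
  have h1 : gram lam h 0 = lam • (1 : Matrix D D ℝ) := by
    ext i j
    simp [gram]
  have h2 : response h η 0 = 0 := by simp [response]
  rw [mixture, selfNormSq, h2, zero_dotProduct, h1, det_smul, det_one, mul_one,
    div_self (pow_ne_zero _ hlam.ne')]
  simp

theorem mixture_succ {lam : ℝ} (hlam : 0 < lam) (v : ℝ) (h : ℕ → D → ℝ) (η : ℕ → ℝ) (k : ℕ) :
    mixture lam v h η (k + 1) = mixture lam v h η k * (√(1 + leverage lam h k))⁻¹
      * Real.exp ((2 * η k * (h k ⬝ᵥ ridge lam h η k) + η k ^ 2 * leverage lam h k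
        - (h k ⬝ᵥ ridge lam h η k) ^ 2) / (1 + leverage lam h k) / (2 * v)) := by
  have hdet := (posDef_gram hlam h k).det_pos
  rw [mixture, mixture, det_gram_succ hlam, selfNormSq_succ hlam, add_div, Real.exp_add,
    ← div_div, Real.sqrt_div' _ (by linarith [leverage_nonneg hlam h k])]
  ring

theorem mixture_nonneg (lam v : ℝ) (h : ℕ → D → ℝ) (η : ℕ → ℝ) (k : ℕ) :
    0 ≤ mixture lam v h η k := by
  rw [mixture]; positivity

theorem measurable_ridge {m : MeasurableSpace Ω} (lam : ℝ) {h : ℕ → Ω → D → ℝ} {η : ℕ → Ω → ℝ}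
    {k : ℕ} (hh : ∀ l < k, Measurable[m] (h l)) (hη : ∀ l < k, Measurable[m] (η l)) :
    Measurable[m] fun ω => ridge lam (fun l => h l ω) (fun l => η l ω) k :=
  measurable_mulVec (measurable_inv_apply (measurable_gram_apply lam hh))
    (measurable_response hh hη)

theorem measurable_mixture {m : MeasurableSpace Ω} (lam v : ℝ) {h : ℕ → Ω → D → ℝ}
    {η : ℕ → Ω → ℝ} {k : ℕ} (hh : ∀ l < k, Measurable[m] (h l))
    (hη : ∀ l < k, Measurable[m] (η l)) :
    Measurable[m] fun ω => mixture lam v (fun l => h l ω) (fun l => η l ω) k :=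
  (Real.continuous_sqrt.measurable.comp
    (measurable_const.div (measurable_det (measurable_gram_apply lam hh)))).mul
    (Real.measurable_exp.comp
      ((measurable_dotProduct (measurable_response hh hη) (measurable_ridge lam hh hη)).div_const _))

/-- Supermartingale property in integrated form over `𝓖 k`-sets, so no integrability of the mixture
has to be shown. -/
theorem setLIntegral_mixture_succ_le {𝓖 : Filtration ℕ mΩ} {lam : ℝ} (hlam : 0 < lam)
    {v : ℝ≥0} (hv : v ≠ 0) {h : ℕ → Ω → D → ℝ} {η : ℕ → Ω → ℝ}
    (hh : ∀ k, Measurable[𝓖 k] (h k)) (hη : ∀ k, Measurable[𝓖 (k + 1)] (η k))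
    (hsub : ∀ k, HasCondSubgaussianMGF (𝓖 k) (𝓖.le k) (η k) v μ) (k : ℕ)
    {s : Set Ω} (hs : MeasurableSet[𝓖 k] s) :
    ∫⁻ ω in s, ENNReal.ofReal (mixture lam v (fun l => h l ω) (fun l => η l ω) (k + 1)) ∂μ
      ≤ ∫⁻ ω in s, ENNReal.ofReal (mixture lam v (fun l => h l ω) (fun l => η l ω) k) ∂μ := by
  have hh' : ∀ l < k, Measurable[𝓖 k] (h l) := fun l hl => (hh l).mono (𝓖.mono hl.le) le_rfl
  have hη' : ∀ l < k, Measurable[𝓖 k] (η l) := fun l hl => (hη l).mono (𝓖.mono hl) le_rfl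
  set Mk : Ω → ℝ := fun ω => mixture lam v (fun l => h l ω) (fun l => η l ω) k with hMk
  set u : Ω → ℝ := fun ω => h k ω ⬝ᵥ ridge lam (fun l => h l ω) (fun l => η l ω) k with hu
  set w : Ω → ℝ := fun ω => leverage lam (fun l => h l ω) k with hw
  have hMm : Measurable[𝓖 k] Mk := measurable_mixture lam v hh' hη'
  have hum : Measurable[𝓖 k] u := measurable_dotProduct (hh k) (measurable_ridge lam hh' hη')
  have hwm : Measurable[𝓖 k] w := measurable_dotProduct (hh k)
    (measurable_mulVec (measurable_inv_apply (measurable_gram_apply lam hh')) (hh k))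
  have hw0 : ∀ ω, 0 ≤ w ω := fun ω => leverage_nonneg hlam _ _
  have hsm : MeasurableSet s := 𝓖.le k _ hs
  set a : Ω → ℝ≥0∞ := s.indicator fun ω => ENNReal.ofReal (Mk ω * (√(1 + w ω))⁻¹) with ha
  have ham : Measurable[𝓖 k] a := by
    refine Measurable.indicator ?_ hs
    fun_prop
  -- The first coordinate carries everything known at time `k`, the second only the noise `η k`;
  -- conditioning freezes the former.
  set F : Ω × Ω → ℝ≥0∞ := fun p => a p.1 * ENNReal.ofReal (Real.exp
    ((2 * η k p.2 * u p.1 + η k p.2 ^ 2 * w p.1 - u p.1 ^ 2) / (1 + w p.1) / (2 * v))) with hF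
  have hηm : Measurable (η k) := (hη k).mono (𝓖.le _) le_rfl
  have hFm : Measurable[(𝓖 k).prod mΩ] F := by
    have f1 := ham.comp (@measurable_fst Ω Ω (𝓖 k) mΩ)
    have f2 := hum.comp (@measurable_fst Ω Ω (𝓖 k) mΩ)
    have f3 := hwm.comp (@measurable_fst Ω Ω (𝓖 k) mΩ)
    have f4 := hηm.comp (@measurable_snd Ω Ω (𝓖 k) mΩ)
    exact f1.mul ((((((f4.const_mul 2).mul f2).add ((f4.pow_const 2).mul f3)).sub
      (f2.pow_const 2)).div (f3.const_add 1)).div_const _).exp.ennreal_ofReal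
  have hleft : ∫⁻ ω in s, ENNReal.ofReal
      (mixture lam v (fun l => h l ω) (fun l => η l ω) (k + 1)) ∂μ = ∫⁻ ω, F (ω, ω) ∂μ := by
    rw [← lintegral_indicator hsm]
    refine lintegral_congr fun ω => ?_
    by_cases hω : ω ∈ s
    · simp only [hF, ha, Set.indicator_of_mem hω]
      rw [mixture_succ hlam, ENNReal.ofReal_mul]
      exact mul_nonneg (mixture_nonneg _ _ _ _ _) (by positivity)
    · simp only [hF, ha, Set.indicator_of_notMem hω, zero_mul]
  rw [hleft, lintegral_diag_eq_lintegral_condExpKernel (𝓖.le k) hFm, ← lintegral_indicator hsm,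
    ← lintegral_trim (𝓖.le k) (f := s.indicator fun ω => ENNReal.ofReal (Mk ω))
      (Measurable.indicator hMm.ennreal_ofReal hs)]
  refine lintegral_mono_ae ?_
  filter_upwards [ae_hasSubgaussianMGF (hsub k)] with ω hω
  simp only [hF]
  rw [lintegral_const_mul _ (by fun_prop)]
  have hmix := lintegral_exp_mixture_le hv hηm hω (u ω) (w ω).toNNReal
  rw [Real.coe_toNNReal _ (hw0 ω)] at hmix
  refine (mul_le_mul_right hmix _).trans ?_
  by_cases hωs : ω ∈ s
  · simp only [ha, Set.indicator_of_mem hωs]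
    have hpos : 0 < √(1 + w ω) := Real.sqrt_pos.2 (by linarith [hw0 ω])
    rw [← ENNReal.ofReal_mul (mul_nonneg (mixture_nonneg _ _ _ _ _) (by positivity)), mul_assoc,
      inv_mul_cancel₀ hpos.ne', mul_one]
  · simp only [ha, Set.indicator_of_notMem hωs, zero_mul, le_refl]

/-- The **self-normalized tail inequality** for vector-valued martingales with conditionally
sub-Gaussian increments, uniform in time. -/
theorem measure_exists_lt_mixture {𝓖 : Filtration ℕ mΩ} {lam : ℝ} (hlam : 0 < lam)
    {v : ℝ≥0} (hv : v ≠ 0) {h : ℕ → Ω → D → ℝ} {η : ℕ → Ω → ℝ}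
    (hh : ∀ k, Measurable[𝓖 k] (h k)) (hη : ∀ k, Measurable[𝓖 (k + 1)] (η k))
    (hsub : ∀ k, HasCondSubgaussianMGF (𝓖 k) (𝓖.le k) (η k) v μ) {ε : ℝ} (hε : 0 < ε) :
    μ {ω | ∃ k, ε⁻¹ < mixture lam v (fun l => h l ω) (fun l => η l ω) k} < ENNReal.ofReal ε := by
  have hville := measure_exists_lt_lt_inv (μ := μ) (𝓖 := 𝓖) (c := ENNReal.ofReal ε⁻¹)
    (M := fun k ω => ENNReal.ofReal (mixture lam v (fun l => h l ω) (fun l => η l ω) k))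
    (fun k => (measurable_mixture lam v (fun l hl => (hh l).mono (𝓖.mono hl.le) le_rfl)
      fun l hl => (hη l).mono (𝓖.mono hl) le_rfl).ennreal_ofReal)
    (by simp [mixture_zero hlam])
    (fun k s hs => setLIntegral_mixture_succ_le hlam hv hh hη hsub k hs)
    (by simpa using hε) ENNReal.ofReal_ne_top
  rw [← ENNReal.ofReal_inv_of_pos (inv_pos.2 hε), inv_inv] at hville
  simpa only [ENNReal.ofReal_lt_ofReal_iff_of_nonneg (inv_pos.2 hε).le] using hville

end SelfNormalized

/-! ### Visitation counts and the confidence radius -/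

theorem freq_dotProduct {D : Type*} [Fintype D] [DecidableEq D] {T : ℕ} (z : Fin T → D)
    (f : D → ℝ) : freq z ⬝ᵥ f = ∑ t, f (z t) := by
  simp only [dotProduct, freq, visit, Finset.sum_mul]
  rw [Finset.sum_comm]
  simp

theorem freq_dotProduct_self_le {D : Type*} [Fintype D] [DecidableEq D] {T : ℕ} (z : Fin T → D) :
    freq z ⬝ᵥ freq z ≤ (T : ℝ) ^ 2 := by
  rw [freq_dotProduct]
  refine (Finset.sum_le_card_nsmul _ _ (T : ℝ) fun t _ => ?_).trans_eq (by simp [sq])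
  rw [freq]
  refine (Finset.sum_le_card_nsmul _ _ (1 : ℝ) fun t' _ => ?_).trans_eq (by simp)
  rw [visit]
  split_ifs <;> norm_num

/-- Strictness comes from `√(λ n)` alone; the logarithmic term is only weakly monotone, as it
vanishes for `T = 0`. -/
theorem radius_lt_radius {T n n' : ℕ} {lam δ : ℝ} (hlam : 0 < lam) (hδ : δ ∈ Set.Ioo (0 : ℝ) 1)
    (hn : n < n') (k : ℕ) : radius T n lam δ k < radius T n' lam δ k := by
  have hn' : (n : ℝ) < n' := by exact_mod_cast hn
  have hlog : 0 ≤ Real.log ((1 + k * (T : ℝ) ^ 2 / lam) / (δ / 10)) := by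
    refine Real.log_nonneg ?_
    rw [le_div_iff₀ (by linarith [hδ.1])]
    have : 0 ≤ k * (T : ℝ) ^ 2 / lam := by positivity
    linarith [hδ.2]
  rw [radius, radius]
  refine add_lt_add_of_le_of_lt (Real.sqrt_le_sqrt ?_) (Real.sqrt_lt_sqrt (by positivity) ?_)
  · gcongr
  · gcongr

/-- A bound on the mixture bounds the self-normalized noise. -/
theorem selfNormSq_le_of_mixture_le {D : Type*} [Fintype D] [DecidableEq D]
    (hD : 2 ≤ Fintype.card D) {lam v ε B : ℝ} (hlam : 0 < lam) (hv : 0 < v) (hε : 0 < ε)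
    (hε1 : ε ≤ 1) {h : ℕ → D → ℝ} (hB : ∀ l, h l ⬝ᵥ h l ≤ B) {η : ℕ → ℝ} {k : ℕ}
    (hM : mixture lam v h η k ≤ ε⁻¹) :
    selfNormSq lam h η k ≤ v * Fintype.card D * Real.log ((1 + k * B / lam) / ε) := by
  have hdet := (posDef_gram hlam h k).det_pos
  have hdetle := det_gram_le hlam h hB k
  set n := Fintype.card D
  have hBk : 0 ≤ (k : ℝ) * B := mul_nonneg k.cast_nonneg
    ((Finset.sum_nonneg fun i _ => mul_self_nonneg (h 0 i)).trans (hB 0))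
  have hpos : 0 < 1 + k * B / lam := by positivity
  have hlog := Real.log_le_log (by rw [mixture]; positivity) hM
  rw [mixture, Real.log_mul (by positivity) (by positivity), Real.log_exp,
    Real.log_sqrt (by positivity), Real.log_div (by positivity) hdet.ne', Real.log_inv] at hlog
  have h1 : Real.log (gram lam h k).det ≤ n * Real.log (1 + k * B / lam) + Real.log (lam ^ n) := by
    rw [← Real.log_pow, ← Real.log_mul (by positivity) (by positivity), ← mul_pow]
    refine Real.log_le_log hdet (hdetle.trans_eq ?_)
    congr 1
    field_simp
  have h2 : Real.log ε ≤ 0 := Real.log_nonpos hε.le hε1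
  -- The mixture bound yields `2 log (1/ε)`; `n ≥ 2` enlarges it to `n log (1/ε)`, so that it merges
  -- with the determinant term.
  have hn : (2 : ℝ) ≤ n := by exact_mod_cast hD
  have h3 : selfNormSq lam h η k / (2 * v) ≤ n * Real.log ((1 + k * B / lam) / ε) / 2 := by
    rw [Real.log_div hpos.ne' hε.ne']
    nlinarith
  rw [div_le_iff₀ (by positivity)] at h3
  linarith

end LatentReward

end

/-! ### The concentration bound -/

theorem proposition1
    {Ω : Type*} [mΩ : MeasurableSpace Ω] [StandardBorelSpace Ω]
    (μ : Measure Ω) [IsProbabilityMeasure μ]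
    {S A D : Type*} [Fintype S] [Fintype A] [Fintype D] [DecidableEq D]
    [MeasurableSpace S] [MeasurableSingletonClass S]
    [MeasurableSpace A] [MeasurableSingletonClass A]
    -- latent-reward encoder, true reward, decoder
    (φ : S × A → D) (hφ : Function.Surjective φ)
    (hD : Fintype.card D < Fintype.card S * Fintype.card A)
    (hD2 : 2 ≤ Fintype.card D)
    (r : S × A → ℝ) (f : D → ℝ) (hr : ∀ x, r x = f (φ x))
    (hf : ‖WithLp.toLp 2 f‖ ≤ √(Fintype.card D : ℝ))
    -- `𝓖 k` is the information available once the trajectory of episode `k` has been completed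
    -- but before its noisy rewards are drawn; `rbar k t` is the noisy reward function at step `t`
    (T : ℕ) (𝓖 : Filtration ℕ mΩ)
    (s : ℕ → Fin T → Ω → S) (a : ℕ → Fin T → Ω → A) (rbar : ℕ → Fin T → D → Ω → ℝ)
    (z : ℕ → Ω → Fin T → D) (hz : ∀ k ω t, z k ω t = φ (s k t ω, a k t ω))
    (R : ℕ → Ω → ℝ)
    (hR : ∀ k ω, R k ω = LatentReward.episodicReturn (fun t d => rbar k t d ω) (z k ω))
    (hs_meas : ∀ k t, Measurable[𝓖 k] (s k t))
    (ha_meas : ∀ k t, Measurable[𝓖 k] (a k t))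
    (hrbar_meas : ∀ k t d, Measurable (rbar k t d))
    (hR_meas : ∀ k, Measurable[𝓖 (k + 1)] (R k))
    -- given `𝓖 k`, the received rewards are independent, `[0, 1]`-valued, with mean `r (s_t, a_t)`
    (h_bdd : ∀ k t, ∀ᵐ ω ∂μ, rbar k t (z k ω t) ω ∈ Set.Icc (0 : ℝ) 1)
    (h_mean : ∀ k t, μ[fun ω => rbar k t (z k ω t) ω | 𝓖 k] =ᵐ[μ]
      fun ω => r (s k t ω, a k t ω))
    (h_indep : ∀ k, iCondIndepFun (𝓖 k) (𝓖.le k)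
      (fun (t : Fin T) ω => rbar k t (z k ω t) ω) μ)
    (lam : ℝ) (hlam : 0 < lam) (δ : ℝ) (hδ : δ ∈ Set.Ioo (0 : ℝ) 1) :
    1 - δ / 10 < μ.real {ω | ∀ k : ℕ,
      LatentReward.matNorm (LatentReward.gram lam (fun l => LatentReward.freq (z l ω)) k)
        (f - LatentReward.ridge lam (fun l => LatentReward.freq (z l ω)) (fun l => R l ω) k)
        ≤ LatentReward.radius T (Fintype.card D) lam δ k} ∧
    ∀ k : ℕ, LatentReward.radius T (Fintype.card D) lam δ k
      < LatentReward.radius T (Fintype.card S * Fintype.card A) lam δ k := by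
  refine ⟨?_, fun k => LatentReward.radius_lt_radius hlam hδ hD k⟩
  have hε : 0 < δ / 10 := by linarith [hδ.1]
  have hε1 : δ / 10 ≤ 1 := by linarith [hδ.2]
  set n := Fintype.card D with hn
  have hff : f ⬝ᵥ f ≤ n := by
    have h1 := EuclideanSpace.real_norm_sq_eq (WithLp.toLp 2 f)
    have h2 := pow_le_pow_left₀ (norm_nonneg _) hf 2
    rw [Real.sq_sqrt (Nat.cast_nonneg _), h1] at h2
    simpa [dotProduct, sq] using h2
  set h : ℕ → Ω → D → ℝ := fun l ω => LatentReward.freq (z l ω) with hh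
  set η : ℕ → Ω → ℝ := fun l ω => R l ω - h l ω ⬝ᵥ f with hη
  have hgood : ∀ ω k,
      LatentReward.selfNormSq lam (fun l => h l ω) (fun l => η l ω) k
        ≤ 1 / 4 * T * n * Real.log ((1 + k * (T : ℝ) ^ 2 / lam) / (δ / 10)) →
      LatentReward.matNorm (LatentReward.gram lam (fun l => h l ω) k)
        (f - LatentReward.ridge lam (fun l => h l ω) (fun l => R l ω) k)
        ≤ LatentReward.radius T n lam δ k := by
    intro ω k hk
    refine (LatentReward.matNorm_sub_ridge_le hlam _ _ f k).trans ?_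
    rw [LatentReward.radius]
    gcongr
  -- For `T = 0` the proxy `T/4` vanishes and the mixture is unavailable; all counts are zero and
  -- the bound is deterministic.
  rcases Nat.eq_zero_or_pos T with rfl | hT
  · have hall : ∀ ω k,
        LatentReward.matNorm (LatentReward.gram lam (fun l => h l ω) k)
          (f - LatentReward.ridge lam (fun l => h l ω) (fun l => R l ω) k)
          ≤ LatentReward.radius 0 n lam δ k := by
      intro ω k
      refine hgood ω k (le_of_eq ?_)
      have h0 : ∀ l, h l ω = 0 := fun l => funext fun d => by simp [hh, LatentReward.freq]
      simp [LatentReward.selfNormSq, LatentReward.response, h0]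
    have huniv : {ω | ∀ k : ℕ,
        LatentReward.matNorm (LatentReward.gram lam (fun l => h l ω) k)
          (f - LatentReward.ridge lam (fun l => h l ω) (fun l => R l ω) k)
          ≤ LatentReward.radius 0 n lam δ k} = Set.univ :=
      Set.eq_univ_of_forall hall
    rw [huniv, probReal_univ]
    linarith
  have hvisit : ∀ k t d, Measurable[𝓖 k] fun ω => LatentReward.visit (z k ω) d t := by
    intro k t d
    simp only [LatentReward.visit, hz]
    exact (Measurable.of_discrete (f := fun x : S × A => if d = φ x then (1 : ℝ) else 0)).comp
      ((hs_meas k t).prodMk (ha_meas k t))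
  have hhm : ∀ k, Measurable[𝓖 k] (h k) := fun k =>
    LatentReward.measurable_freq (hvisit k)
  have hηm : ∀ k, Measurable[𝓖 (k + 1)] (η k) := fun k =>
    (hR_meas k).sub (LatentReward.measurable_dotProduct
      ((hhm k).mono (𝓖.mono k.le_succ) le_rfl) measurable_const)
  have hXm : ∀ k t, Measurable fun ω => rbar k t (z k ω t) ω := by
    intro k t
    -- Evaluation at the random index becomes a finite sum of indicators times measurable functions.
    have h1 : (fun ω => rbar k t (z k ω t) ω)
        = fun ω => ∑ d, LatentReward.visit (z k ω) d t * rbar k t d ω := by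
      ext ω
      simp [LatentReward.visit]
    rw [h1]
    exact Finset.measurable_sum _ fun d _ =>
      ((hvisit k t d).mono (𝓖.le k) le_rfl).mul (hrbar_meas k t d)
  have hgm : ∀ k t, Measurable[𝓖 k] fun ω => r (s k t ω, a k t ω) := fun k t =>
    (Measurable.of_discrete (f := r)).comp ((hs_meas k t).prodMk (ha_meas k t))
  have hsub : ∀ k, HasCondSubgaussianMGF (𝓖 k) (𝓖.le k) (η k)
      (Fintype.card (Fin T) * (1 / 4)) μ := by
    intro k
    have h1 := LatentReward.hasCondSubgaussianMGF_sum_sub (𝓖.le k) (hXm k) (hgm k) (h_bdd k)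
      (h_mean k) (h_indep k)
    have h2 : η k = fun ω => ∑ t, rbar k t (z k ω t) ω - ∑ t, r (s k t ω, a k t ω) := by
      ext ω
      simp only [hη, hh, hR, LatentReward.episodicReturn_eq, LatentReward.freq_dotProduct, hr, hz]
    rw [h2]
    exact h1
  have hv : ((Fintype.card (Fin T) : NNReal) * (1 / 4)) ≠ 0 := by
    rw [Fintype.card_fin]
    positivity
  have hbad := LatentReward.measure_exists_lt_mixture hlam hv hhm hηm hsub hε
  set bad := {ω | ∃ k, (δ / 10)⁻¹ < LatentReward.mixture lam
    ((Fintype.card (Fin T) : NNReal) * (1 / 4) : NNReal) (fun l => h l ω) (fun l => η l ω) k}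
    with hbad_def
  have hbad_meas : MeasurableSet bad := by
    rw [hbad_def, Set.ofPred_exists]
    refine MeasurableSet.iUnion fun k => measurableSet_lt measurable_const ?_
    exact LatentReward.measurable_mixture lam _ (fun l _ => (hhm l).mono (𝓖.le l) le_rfl)
      fun l _ => (hηm l).mono (𝓖.le _) le_rfl
  have hbad_real : μ.real bad < δ / 10 := by
    rw [measureReal_def]
    exact (ENNReal.lt_ofReal_iff_toReal_lt (measure_ne_top _ _)).1 hbad
  have hcompl : μ.real badᶜ = 1 - μ.real bad := probReal_compl_eq_one_sub hbad_meas
  refine lt_of_lt_of_le (by linarith : 1 - δ / 10 < μ.real badᶜ) (measureReal_mono ?_)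
  intro ω hω k
  refine hgood ω k ?_
  have hle : LatentReward.mixture lam ((Fintype.card (Fin T) : NNReal) * (1 / 4) : NNReal)
      (fun l => h l ω) (fun l => η l ω) k ≤ (δ / 10)⁻¹ := not_lt.1 fun hlt => hω ⟨k, hlt⟩
  refine (LatentReward.selfNormSq_le_of_mixture_le hD2 hlam (NNReal.coe_pos.2 (pos_iff_ne_zero.2 hv))
    hε hε1 (fun l => LatentReward.freq_dotProduct_self_le (z l ω)) hle).trans_eq ?_
  simp only [Fintype.card_fin, NNReal.coe_mul, NNReal.coe_natCast, NNReal.coe_div, NNReal.coe_one,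
    NNReal.coe_ofNat]
  ring
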